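/- Let $|\cdot|$ be the Euclidean norm on $\mathbb R^3$ and, for each $z\in\mathbb R^3$, let $[z]\in\mathbb Z^3$ be a lattice point at minimal Euclidean distance from $z$ (ties broken arbitrarily). For $x\in\mathbb Z^3\setminus\{0\}$, let $e=x/|x|$ and define the oblique discrete segment and tubes $$T(x)=\{[je]: j\in\mathbb Z,\ 0\le j\le\lceil |x|\rceil\},\qquad T(x,r)=\{y\in\mathbb Z^3: d(y,T(x))\le r\}\quad (r\ge 0),$$ where $d$ is Euclidean distance. Let $P_y$ be the law of the continuous-time simple random walk $(X_t)_{t\ge0}$ on $\mathbb Z^3$ started at $y$, with independent mean one exponential holding times, and let $H_K=\inf\{t\ge0: X_t\in K\}$ (with $\inf\emptyset=\infty$) for $K\subset\mathbb Z^3$. There is an absolute constant $c>0$ such that for all $\delta,\varepsilon\in(0,1)$ there is a constant $C=C(\delta,\varepsilon)\in(0,\infty)$ such that, for every choice of the nearest-point map $z\mapsto[z]$ and every $x\in\mathbb Z^3$ with $|x|\ge C$, $$\inf_{y\in\mathbb Z^3\setminus T(x,|x|^{\delta})} P_y\big[H_{T(x,|x|^{(1-\varepsilon)\delta})}=\infty\big]\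 \ge\ c\,\delta\,\varepsilon .$$ -/

import Mathlib

open MeasureTheory ProbabilityTheory
open scoped NNReal ENNReal

noncomputable section

/-! ### Geometry: the lattice in Euclidean space and the discretised oblique tubes -/

/-- The embedding of the lattice `ℤ^d` into Euclidean space `ℝ^d`. -/
def latticeEmb {d : ℕ} (x : Fin d → ℤ) : EuclideanSpace ℝ (Fin d) :=
  WithLp.toLp 2 (fun i => (x i : ℝ))

/-- The Euclidean norm `|x|` of a lattice point. -/
def latticeNorm {d : ℕ} (x : Fin d → ℤ) : ℝ := ‖latticeEmb x‖

/-- `rnd` selects, for every `z ∈ ℝ^d`, a lattice point `[z]` at minimal Euclidean distance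
from `z`; ties may be broken arbitrarily. -/
def IsNearestLatticePoint {d : ℕ} (rnd : EuclideanSpace ℝ (Fin d) → Fin d → ℤ) : Prop :=
  ∀ (z : EuclideanSpace ℝ (Fin d)) (w : Fin d → ℤ),
    dist z (latticeEmb (rnd z)) ≤ dist z (latticeEmb w)

/-- The direction `e = x / |x|`. -/
def latticeDir {d : ℕ} (x : Fin d → ℤ) : EuclideanSpace ℝ (Fin d) :=
  (latticeNorm x)⁻¹ • latticeEmb x

/-- The discretised segment `T(x) = {[j e] : 0 ≤ j ≤ ⌈|x|⌉}` from `0` to `x`. -/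
def obliqueLine {d : ℕ} (rnd : EuclideanSpace ℝ (Fin d) → Fin d → ℤ) (x : Fin d → ℤ) :
    Set (Fin d → ℤ) :=
  {y | ∃ j : ℕ, j ≤ ⌈latticeNorm x⌉₊ ∧ y = rnd ((j : ℝ) • latticeDir x)}

/-- The oblique tube `T(x, r) = {y ∈ ℤ^d : d(y, T(x)) ≤ r}` (Euclidean distance). -/
def obliqueTube {d : ℕ} (rnd : EuclideanSpace ℝ (Fin d) → Fin d → ℤ) (x : Fin d → ℤ) (r : ℝ) :
    Set (Fin d → ℤ) :=
  {y | Metric.infDist (latticeEmb y) (latticeEmb '' obliqueLine rnd x) ≤ r}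

/-! ### The continuous-time simple random walk with mean one exponential holding times -/

/-- The increment of the walk encoded by a coordinate direction and a sign:
`(i, true)` is `+ e_i` and `(i, false)` is `- e_i`. -/
def unitStep {d : ℕ} (s : Fin d × Bool) : Fin d → ℤ :=
  Pi.single s.1 (if s.2 then 1 else -1)

/-- The sample space of the walk: a sequence of steps and a sequence of holding times. -/
abbrev WalkSpace (d : ℕ) : Type := (ℕ → Fin d × Bool) × (ℕ → ℝ)

/-- The position of the discrete skeleton started at `y` after `n` jumps. -/
def skeleton {d : ℕ} (y : Fin d → ℤ) (ω : WalkSpace d) (n : ℕ) : Fin d → ℤ :=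
  y + ∑ k ∈ Finset.range n, unitStep (ω.1 k)

/-- The time of the `n`-th jump, i.e. the sum of the first `n` holding times. -/
def jumpTime {d : ℕ} (ω : WalkSpace d) (n : ℕ) : ℝ :=
  ∑ k ∈ Finset.range n, ω.2 k

/-- The number of jumps up to time `t`: the least `n` such that the `(n+1)`-st jump occurs
after time `t`. Such an `n` exists for all `t` almost surely. -/
def jumpCount {d : ℕ} (ω : WalkSpace d) (t : ℝ≥0) : ℕ :=
  sInf {n : ℕ | (t : ℝ) < jumpTime ω (n + 1)}

/-- The position `X_t` at time `t` of the continuous-time random walk started at `y`. -/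
def ctWalk {d : ℕ} (y : Fin d → ℤ) (t : ℝ≥0) (ω : WalkSpace d) : Fin d → ℤ :=
  skeleton y ω (jumpCount ω t)

/-- The law of one holding time: the exponential distribution with mean one. -/
def holdingLaw : Measure ℝ := expMeasure 1

instance : IsProbabilityMeasure holdingLaw :=
  isProbabilityMeasure_expMeasure one_pos

/-- The law of one step: uniform on the `2d` signed coordinate directions. -/
def stepLaw (d : ℕ) [NeZero d] : Measure (Fin d × Bool) :=
  (PMF.uniformOfFintype (Fin d × Bool)).toMeasure

instance (d : ℕ) [NeZero d] : IsProbabilityMeasure (stepLaw d) :=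
  PMF.toMeasure.isProbabilityMeasure _

/-- The driving measure: independent uniform steps and, independently of these, independent
mean one exponential holding times. -/
def walkMeasure (d : ℕ) [NeZero d] : Measure (WalkSpace d) :=
  (Measure.infinitePi fun _ : ℕ => stepLaw d).prod (Measure.infinitePi fun _ : ℕ => holdingLaw)

/-- The entrance time `H_K = inf {t ≥ 0 : X_t ∈ K}` of the walk started at `y`, with the value
`⊤` (infinity) if the walk never visits `K`. -/
def entranceTime {d : ℕ} (y : Fin d → ℤ) (K : Set (Fin d → ℤ)) (ω : WalkSpace d) :
    WithTop ℝ≥0 :=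
  hittingAfter (ctWalk y) K 0 ω

/-- The probability `P_y[H_K = ∞]` that the walk started at `y` never visits `K`. -/
def escapeProb {d : ℕ} [NeZero d] (y : Fin d → ℤ) (K : Set (Fin d → ℤ)) : ℝ≥0∞ :=
  walkMeasure d {ω | entranceTime y K ω = ⊤}

end

/-!
A nonnegative function on `ℤ³` that is superharmonic for the walk and at least `m` on `K` bounds
the probability of ever visiting `K` from `y` by its value at `y` divided by `m`
(`le_escapeProb`). So it suffices to exhibit such a function for the tubes, and it can be given
explicitly.

The regularised Newtonian kernel `(|w|² + s)^(-1/2)` is superharmonic for the lattice walk,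
wherever its pole lies in `ℝ³`, once `s ≥ 100` (`sum_newtonKernel_le`). Integrating it over the
segment `[0, x]`, with `N = |x|`, gives a potential that is about `2 log (N / ρ)` at distance `ρ`
from the middle of the segment, but only about half as large near the ends. To compensate, the
segment is prolonged at both ends. A straight prolongation would be near some points that are far
from the tube; instead both prolongations leave `ℝ³` orthogonally, in a fourth dimension, which
merely amounts to replacing `s` by `s + t²` in the kernel. The resulting `segmentPotential` is an
elementary function (`segmentPotential_eq`). It is at least `2 log (N / ρ) - O(1)` at distance
at most `ρ ≥ 1` from the segment (`log_le_segmentPotential`), and at most `2 log (N / ρ) + O(1)`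
at distance at least `ρ` when `ρ ≤ N` (`segmentPotential_le_log`).

With `ρ = N ^ δ` outside the large tube and `ρ = N ^ ((1 - ε) δ)` inside the small one, the ratio
of the two values is at most `(1 - δ) / (1 - δ + δ ε) + o(1)`, and hence at most `1 - δ ε / 2` for
large `N`.
-/

/-! ### Escape probabilities from superharmonic functions -/

/-- The law of an i.i.d. sequence is unchanged when an independent term with the same law is
prepended. -/
lemma measurePreserving_natCases_infinitePi {α : Type*} [MeasurableSpace α] (ν : Measure α)
    [IsProbabilityMeasure ν] :
    MeasurePreserving (fun p : α × (ℕ → α) => (fun n => Nat.casesOn n p.1 p.2 : ℕ → α))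
      (ν.prod (Measure.infinitePi fun _ : ℕ => ν)) (Measure.infinitePi fun _ : ℕ => ν) := by
  have hmeas : Measurable
      (fun p : α × (ℕ → α) => (fun n => Nat.casesOn n p.1 p.2 : ℕ → α)) := by
    refine measurable_pi_lambda _ fun n => ?_
    cases n with
    | zero => exact measurable_fst
    | succ n => exact (measurable_pi_apply n).comp measurable_snd
  refine ⟨hmeas, Measure.eq_infinitePi _ fun s t ht => ?_⟩
  -- Enlarging `s` to `range (M + 1)` with trivial constraints makes the preimage a product.
  obtain ⟨M, hM⟩ := s.exists_nat_subset_range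
  classical
  set t' : ℕ → Set α := fun i => if i ∈ s then t i else Set.univ with ht'
  have hset : Set.pi (s : Set ℕ) t = Set.pi (Finset.range (M + 1) : Set ℕ) t' := by
    ext ω
    simp only [Set.mem_pi, ht']
    constructor
    · intro h i _
      by_cases hi : i ∈ s
      · simpa [hi] using h i hi
      · simp [hi]
    · intro h i hi
      have hi' : i ∈ s := hi
      have := h i (by
        have := Finset.mem_range.1 (hM hi'); simp; omega)
      simpa [hi'] using this
  have ht'm : ∀ i, MeasurableSet (t' i) := fun i => by
    by_cases hi : i ∈ s <;> simp [ht', hi, ht i]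
  have hprod : ∏ i ∈ s, ν (t i) = ∏ i ∈ Finset.range (M + 1), ν (t' i) := by
    rw [← Finset.prod_subset (hM.trans (Finset.range_subset_range.2 (Nat.le_succ M)))]
    · exact Finset.prod_congr rfl fun i hi => by simp [ht', hi]
    · intro i _ hi
      simp [ht', hi]
  have hpre : (fun p : α × (ℕ → α) => (fun n => Nat.casesOn n p.1 p.2 : ℕ → α)) ⁻¹'
      Set.pi (Finset.range (M + 1) : Set ℕ) t' =
      t' 0 ×ˢ Set.pi (Finset.range M : Set ℕ) (fun i => t' (i + 1)) := by
    ext p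
    simp only [Set.mem_preimage, Set.mem_pi, Set.mem_prod, Finset.coe_range, Set.mem_Iio]
    constructor
    · exact fun h => ⟨h 0 (by omega), fun i hi => h (i + 1) (by omega)⟩
    · rintro ⟨h0, h⟩ i hi
      cases i with
      | zero => exact h0
      | succ i => exact h i (by omega)
  rw [hset, hprod, Measure.map_apply hmeas
    (MeasurableSet.pi (Finset.countable_toSet _) fun i _ => ht'm i), hpre, Measure.prod_prod,
    Measure.infinitePi_pi _ fun i _ => ht'm _, Finset.prod_range_succ', mul_comm]

/-- The skeleton walk with the given steps, started at `y`, visits `K` within `n` steps. -/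
def hitsWithin {d : ℕ} (K : Set (Fin d → ℤ)) (n : ℕ) (y : Fin d → ℤ) :
    Set (ℕ → Fin d × Bool) :=
  {σ | ∃ k ≤ n, y + ∑ i ∈ Finset.range k, unitStep (σ i) ∈ K}

lemma measurableSet_hitsWithin {d : ℕ} (K : Set (Fin d → ℤ)) (n : ℕ) (y : Fin d → ℤ) :
    MeasurableSet (hitsWithin K n y) := by
  have : hitsWithin K n y = ⋃ k ∈ Set.Iic n,
      (fun σ : ℕ → Fin d × Bool => y + ∑ i ∈ Finset.range k, unitStep (σ i)) ⁻¹' K := by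
    ext σ; simp [hitsWithin]
  rw [this]
  refine MeasurableSet.biUnion (Set.to_countable _) fun k _ => ?_
  have hm : Measurable
      (fun σ : ℕ → Fin d × Bool => y + ∑ i ∈ Finset.range k, unitStep (σ i)) := by
    refine Measurable.const_add (Finset.measurable_sum _ fun i _ => ?_) y
    exact (measurable_of_countable unitStep).comp (measurable_pi_apply i)
  exact hm (Set.to_countable K).measurableSet

/-- The first step decomposition of the hitting event. -/
lemma cons_mem_hitsWithin_succ {d : ℕ} {K : Set (Fin d → ℤ)} {n : ℕ} {y : Fin d → ℤ}
    (hy : y ∉ K) (s : Fin d × Bool) (σ : ℕ → Fin d × Bool) :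
    (fun k => Nat.casesOn k s σ : ℕ → Fin d × Bool) ∈ hitsWithin K (n + 1) y ↔
      σ ∈ hitsWithin K n (y + unitStep s) := by
  simp only [hitsWithin, Set.mem_ofPred_eq]
  constructor
  · rintro ⟨k, hk, h⟩
    cases k with
    | zero => exact absurd (by simpa using h) hy
    | succ k =>
      refine ⟨k, by omega, ?_⟩
      rw [Finset.sum_range_succ'] at h
      rwa [add_assoc, add_comm (unitStep s)]
  · rintro ⟨k, hk, h⟩
    refine ⟨k + 1, by omega, ?_⟩
    rw [Finset.sum_range_succ']
    rwa [add_assoc, add_comm (unitStep s)] at h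

lemma stepLaw_singleton {d : ℕ} [NeZero d] (s : Fin d × Bool) :
    stepLaw d {s} = ENNReal.ofReal ((2 * d : ℝ)⁻¹) := by
  have hd : (0 : ℝ) < 2 * d := by
    have := Nat.pos_of_ne_zero (NeZero.ne d); positivity
  rw [stepLaw, PMF.toMeasure_apply_singleton _ _ (MeasurableSet.singleton s),
    PMF.uniformOfFintype_apply, ENNReal.ofReal_inv_of_pos hd]
  congr 1
  rw [show (2 * d : ℝ) = ((2 * d : ℕ) : ℝ) by push_cast; ring, ENNReal.ofReal_natCast]
  simp [mul_comm]

/-- The maximal inequality for a nonnegative superharmonic function along the skeleton walk. -/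
lemma measure_hitsWithin_le {d : ℕ} [NeZero d] {f : (Fin d → ℤ) → ℝ} {K : Set (Fin d → ℤ)}
    {m : ℝ} (hf0 : ∀ y, 0 ≤ f y) (hf : ∀ y, ∑ s, f (y + unitStep s) ≤ 2 * d * f y)
    (hm : 0 < m) (hK : ∀ y ∈ K, m ≤ f y) (n : ℕ) (y : Fin d → ℤ) :
    (Measure.infinitePi fun _ : ℕ => stepLaw d) (hitsWithin K n y) ≤
      ENNReal.ofReal (f y / m) := by
  have hd : (0 : ℝ) < 2 * d := by
    have := Nat.pos_of_ne_zero (NeZero.ne d); positivity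
  induction n generalizing y with
  | zero =>
    by_cases hy : y ∈ K
    · exact prob_le_one.trans (by
        rw [← ENNReal.ofReal_one]
        exact ENNReal.ofReal_le_ofReal ((one_le_div hm).2 (hK y hy)))
    · have : hitsWithin K 0 y = ∅ := by
        ext σ; simp [hitsWithin, hy]
      simp [this]
  | succ n ih =>
    by_cases hy : y ∈ K
    · exact prob_le_one.trans (by
        rw [← ENNReal.ofReal_one]
        exact ENNReal.ofReal_le_ofReal ((one_le_div hm).2 (hK y hy)))
    have hmp := measurePreserving_natCases_infinitePi (stepLaw d)
    have hms := measurableSet_hitsWithin K (n + 1) y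
    rw [← hmp.measure_preimage hms.nullMeasurableSet,
      Measure.prod_apply (hmp.measurable hms), lintegral_fintype]
    calc _ ≤ ∑ s, ENNReal.ofReal (f (y + unitStep s) / m * (2 * d : ℝ)⁻¹) := by
          refine Finset.sum_le_sum fun s _ => ?_
          rw [stepLaw_singleton, ENNReal.ofReal_mul (div_nonneg (hf0 _) hm.le)]
          gcongr
          refine le_trans (le_of_eq ?_) (ih (y + unitStep s))
          congr 1
          ext σ
          exact cons_mem_hitsWithin_succ hy s σ
      _ = ENNReal.ofReal ((∑ s, f (y + unitStep s)) / m * (2 * d : ℝ)⁻¹) := by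
          rw [← ENNReal.ofReal_sum_of_nonneg fun s _ =>
            mul_nonneg (div_nonneg (hf0 _) hm.le) (inv_nonneg.2 hd.le),
            ← Finset.sum_mul, ← Finset.sum_div]
      _ ≤ _ := by
          refine ENNReal.ofReal_le_ofReal ?_
          rw [← div_eq_mul_inv, div_le_iff₀ hd, div_mul_eq_mul_div]
          gcongr
          linarith [hf y]

/-- A nonnegative superharmonic function that is at least `m` on `K` bounds the escape
probability from below. Only the skeleton matters: the walk is at every time at some point of
its skeleton, so the holding times play no role. -/
lemma le_escapeProb {d : ℕ} [NeZero d] {f : (Fin d → ℤ) → ℝ} {K : Set (Fin d → ℤ)}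
    {m : ℝ} (hf0 : ∀ y, 0 ≤ f y) (hf : ∀ y, ∑ s, f (y + unitStep s) ≤ 2 * d * f y)
    (hm : 0 < m) (hK : ∀ y ∈ K, m ≤ f y) (y : Fin d → ℤ) :
    ENNReal.ofReal (1 - f y / m) ≤ escapeProb y K := by
  set μ := Measure.infinitePi fun _ : ℕ => stepLaw d
  have hmono : Monotone fun n => hitsWithin K n y := by
    rintro a b hab σ ⟨k, hk, h⟩
    exact ⟨k, hk.trans hab, h⟩
  have hU : μ (⋃ n, hitsWithin K n y) ≤ ENNReal.ofReal (f y / m) := by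
    rw [hmono.measure_iUnion]
    exact iSup_le fun n => measure_hitsWithin_le hf0 hf hm hK n y
  have hUm : MeasurableSet (⋃ n, hitsWithin K n y) :=
    MeasurableSet.iUnion fun n => measurableSet_hitsWithin K n y
  have hsub : (⋃ n, hitsWithin K n y)ᶜ ×ˢ (Set.univ : Set (ℕ → ℝ)) ⊆
      {ω : WalkSpace d | entranceTime y K ω = ⊤} := by
    rintro ω ⟨hω, -⟩
    simp only [Set.mem_ofPred_eq, entranceTime, hittingAfter_eq_top_iff]
    intro t _ ht
    exact hω (Set.mem_iUnion.2 ⟨_, _, le_rfl, ht⟩)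
  refine le_trans ?_ (measure_mono hsub)
  rw [walkMeasure, Measure.prod_prod, measure_univ, mul_one, prob_compl_eq_one_sub hUm,
    ENNReal.ofReal_sub _ (div_nonneg (hf0 y) hm.le), ENNReal.ofReal_one]
  exact tsub_le_tsub_left hU 1

/-! ### A superharmonic kernel -/

/-- The regularised Newtonian kernel `(|w|² + s)^(-1/2)` on `ℝ³`. -/
noncomputable def newtonKernel (w : EuclideanSpace ℝ (Fin 3)) (s : ℝ) : ℝ :=
  (√(‖w‖ ^ 2 + s))⁻¹

lemma newtonKernel_nonneg (w : EuclideanSpace ℝ (Fin 3)) (s : ℝ) : 0 ≤ newtonKernel w s :=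
  inv_nonneg.2 (Real.sqrt_nonneg _)

/-- Upper bound for `(1 + v)^(-1/2)` by its Taylor polynomial of degree three plus a quartic
remainder. -/
lemma inv_sqrt_one_add_le {v : ℝ} (hv : |v| ≤ 1 / 2) :
    (√(1 + v))⁻¹ ≤ 1 - v / 2 + 3 / 8 * v ^ 2 - 5 / 16 * v ^ 3 + v ^ 4 := by
  obtain ⟨h1, h2⟩ := abs_le.1 hv
  have hq : 0 ≤ 1 - v / 2 + 3 / 8 * v ^ 2 - 5 / 16 * v ^ 3 + v ^ 4 := by
    nlinarith [sq_nonneg (v ^ 2), mul_nonneg (sq_nonneg v) (by linarith : 0 ≤ 1 / 2 - v)]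
  have hs : 0 < √(1 + v) := Real.sqrt_pos.2 (by linarith)
  rw [inv_le_iff_one_le_mul₀ hs]
  refine le_of_sq_le_sq ?_ (by positivity)
  rw [mul_pow, Real.sq_sqrt (by linarith)]
  have h3 : |v ^ 2| ≤ (1 / 2) ^ 2 := by rw [abs_pow]; gcongr
  have h4 : |v ^ 3| ≤ (1 / 2) ^ 3 := by rw [abs_pow]; gcongr
  have h5 : |v ^ 5| ≤ (1 / 2) ^ 5 := by rw [abs_pow]; gcongr
  have hpos : 0 ≤ 93 / 64 + 78 / 64 * v - 99 / 256 * v ^ 2 + 57 / 256 * v ^ 3 + 3 / 8 * v ^ 4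
      + v ^ 5 := by
    have h6 : 0 ≤ v ^ 4 := by positivity
    rw [abs_le] at h3 h4 h5
    linarith [h3.2, h4.1, h5.1]
  have := mul_nonneg (by positivity : 0 ≤ v ^ 4) hpos
  linear_combination this

/-- The second difference of `(1 + ·)^(-1/2)` around `u` in direction `w`. -/
lemma inv_sqrt_add_inv_sqrt_le {u w : ℝ} (hu0 : 0 ≤ u) (hu : u ≤ 1 / 100) (hw : |w| ≤ 1 / 5) :
    (√(1 + (u + w)))⁻¹ + (√(1 + (u - w)))⁻¹ ≤
      2 - u + 3 / 4 * u ^ 2 + 3 / 4 * w ^ 2 + 2 * w ^ 4 := by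
  obtain ⟨h1, h2⟩ := abs_le.1 hw
  have ha := inv_sqrt_one_add_le (v := u + w) (abs_le.2 ⟨by linarith, by linarith⟩)
  have hb := inv_sqrt_one_add_le (v := u - w) (abs_le.2 ⟨by linarith, by linarith⟩)
  have h3 : 0 ≤ u * w ^ 2 * (30 / 16 - 12 * u) := by
    have : 0 ≤ 30 / 16 - 12 * u := by linarith
    positivity
  have h4 : 0 ≤ u ^ 3 * (5 / 8 - 2 * u) := by
    have : 0 ≤ 5 / 8 - 2 * u := by linarith
    positivity
  linear_combination ha + hb + h3 + h4

lemma norm_sq_add_latticeEmb_unitStep {d : ℕ} (w : EuclideanSpace ℝ (Fin d))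
    (s : Fin d × Bool) :
    ‖w + latticeEmb (unitStep s)‖ ^ 2 =
      ‖w‖ ^ 2 + (1 + (if s.2 then 1 else -1) * (2 * w s.1)) := by
  have h : latticeEmb (unitStep s) =
      EuclideanSpace.single s.1 (if s.2 then (1 : ℝ) else -1) := by
    ext i
    obtain ⟨j, b⟩ := s
    by_cases hij : i = j
    · subst hij; cases b <;> simp [latticeEmb, unitStep]
    · cases b <;> simp [latticeEmb, unitStep, hij]
  rw [h, norm_add_sq_real, EuclideanSpace.inner_single_right, PiLp.norm_single]
  obtain ⟨j, b⟩ := s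
  cases b <;> simp <;> ring

/-- The kernel is superharmonic for the nearest neighbour walk: the Laplacian contributes
`-3 s (|w|² + s)^(-5/2)`, which beats the discretisation error, of order
`(|w|² + s)^(-5/2)`, as soon as `s` is large. -/
lemma sum_newtonKernel_le (w : EuclideanSpace ℝ (Fin 3)) {s : ℝ} (hs : 100 ≤ s) :
    ∑ σ : Fin 3 × Bool, newtonKernel (w + latticeEmb (unitStep σ)) s ≤
      6 * newtonKernel w s := by
  set S := ‖w‖ ^ 2 + s with hS
  have hS100 : 100 ≤ S := by nlinarith [sq_nonneg ‖w‖]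
  have hS0 : 0 < S := by linarith
  set u := S⁻¹ with hu
  have hu0 : 0 < u := inv_pos.2 hS0
  have hSu : S * u = 1 := mul_inv_cancel₀ hS0.ne'
  have hu1 : u ≤ 1 / 100 := by rw [hu, inv_le_comm₀ hS0 (by norm_num)]; norm_num; exact hS100
  have hnorm : ‖w‖ ^ 2 = ∑ i, w i ^ 2 := by
    rw [EuclideanSpace.norm_sq_eq]; simp
  have hfac : ∀ v : ℝ, (√(S * (1 + v)))⁻¹ = (√S)⁻¹ * (√(1 + v))⁻¹ := fun v => by
    rw [Real.sqrt_mul hS0.le, mul_inv]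
  have hterm : ∀ i, newtonKernel (w + latticeEmb (unitStep (i, true))) s +
      newtonKernel (w + latticeEmb (unitStep (i, false))) s ≤
      (√S)⁻¹ * (2 - u + 3 / 4 * u ^ 2 + 3 / 4 * (2 * w i * u) ^ 2 + 2 * (2 * w i * u) ^ 4) := by
    intro i
    have hwi : w i ^ 2 ≤ S := by
      have := Finset.single_le_sum (f := fun i => w i ^ 2) (fun i _ => sq_nonneg _)
        (Finset.mem_univ i)
      rw [hS, hnorm]; linarith
    have hle : |2 * w i * u| ≤ 1 / 5 := by
      refine abs_le_of_sq_le_sq ?_ (by norm_num)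
      calc (2 * w i * u) ^ 2 = 4 * (w i ^ 2 * u) * u := by ring
        _ ≤ 4 * (S * u) * u := by gcongr
        _ ≤ (1 / 5) ^ 2 := by rw [hSu]; linarith
    have e1 : ‖w‖ ^ 2 + (1 + 2 * w i) + s = S * (1 + (u + 2 * w i * u)) := by
      linear_combination -hS - (1 + 2 * w i) * hSu
    have e2 : ‖w‖ ^ 2 + (1 + -(2 * w i)) + s = S * (1 + (u - 2 * w i * u)) := by
      linear_combination -hS - (1 - 2 * w i) * hSu
    simp only [newtonKernel, norm_sq_add_latticeEmb_unitStep, if_true, one_mul,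
      Bool.false_eq_true, if_false, neg_one_mul]
    rw [e1, e2, hfac, hfac, ← mul_add]
    exact mul_le_mul_of_nonneg_left (inv_sqrt_add_inv_sqrt_le hu0.le hu1 hle)
      (inv_nonneg.2 (Real.sqrt_nonneg _))
  have hsum : ∑ i, (2 * w i * u) ^ 2 = 4 * u - 4 * s * u ^ 2 := by
    have : ∑ i, (2 * w i * u) ^ 2 = 4 * u ^ 2 * ∑ i, w i ^ 2 := by
      rw [Finset.mul_sum]; exact Finset.sum_congr rfl fun i _ => by ring
    rw [this, ← hnorm]
    linear_combination (-4 * u ^ 2) * hS + 4 * u * hSu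
  rw [Fintype.sum_prod_type]
  simp only [Fintype.sum_bool]
  refine (Finset.sum_le_sum fun i _ => hterm i).trans ?_
  rw [← Finset.mul_sum, mul_comm 6]
  change _ ≤ (√S)⁻¹ * 6
  gcongr
  simp only [Fin.sum_univ_three] at hsum ⊢
  set p := (2 * w 0 * u) ^ 2 with hp
  set q := (2 * w 1 * u) ^ 2 with hq
  set r := (2 * w 2 * u) ^ 2 with hr
  have hp0 : 0 ≤ p := sq_nonneg _
  have hq0 : 0 ≤ q := sq_nonneg _
  have hr0 : 0 ≤ r := sq_nonneg _
  have e4 : ∀ a : ℝ, a ^ 4 = (a ^ 2) ^ 2 := fun a => by ring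
  rw [e4, e4, e4, ← hp, ← hq, ← hr]
  have h4 : p ^ 2 + q ^ 2 + r ^ 2 ≤ 16 * u ^ 2 := by
    have hle : p + q + r ≤ 4 * u := by
      rw [hsum]; have : 0 ≤ s * u ^ 2 := by positivity
      linarith
    have : (p + q + r) ^ 2 ≤ (4 * u) ^ 2 := by gcongr
    nlinarith [mul_nonneg hp0 hq0, mul_nonneg hp0 hr0, mul_nonneg hq0 hr0]
  have h5 : 100 * u ^ 2 ≤ s * u ^ 2 := by gcongr
  nlinarith [sq_nonneg u]

open intervalIntegral

/-! ### The potential of a segment -/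

/-- The primitive is `t ↦ log (t - τ + √((t - τ) ^ 2 + Q))`. -/
lemma integral_inv_sqrt_sub_sq_add (τ N : ℝ) {Q : ℝ} (hQ : 0 < Q) :
    ∫ t in (0 : ℝ)..N, (√((t - τ) ^ 2 + Q))⁻¹ =
      Real.log (N - τ + √((N - τ) ^ 2 + Q)) - Real.log (√(τ ^ 2 + Q) - τ) := by
  have hlt : ∀ y : ℝ, 0 < y + √(y ^ 2 + Q) := fun y => by
    have : |y| < √(y ^ 2 + Q) := by
      rw [← Real.sqrt_sq_eq_abs]; exact Real.sqrt_lt_sqrt (sq_nonneg y) (by linarith)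
    linarith [neg_abs_le y]
  have hpos : ∀ t : ℝ, 0 < (t - τ) ^ 2 + Q := fun t => by positivity
  have hder : ∀ t ∈ Set.uIcc 0 N, HasDerivAt
      (fun t => Real.log (t - τ + √((t - τ) ^ 2 + Q))) (√((t - τ) ^ 2 + Q))⁻¹ t := by
    intro t _
    have h1 : HasDerivAt (fun t : ℝ => t - τ) 1 t := (hasDerivAt_id t).sub_const τ
    have h2 := ((h1.pow 2).add_const Q).sqrt (hpos t).ne'
    have h3 := (h1.add h2).log (hlt (t - τ)).ne'
    refine h3.congr_deriv ?_
    have hs : 0 < √((t - τ) ^ 2 + Q) := Real.sqrt_pos.2 (hpos t)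
    have := hlt (t - τ)
    simp only [Pi.pow_apply, Pi.add_apply]
    field_simp
    ring
  have hcont : Continuous fun t : ℝ => (√((t - τ) ^ 2 + Q))⁻¹ :=
    Continuous.inv₀ (by fun_prop) fun t => (Real.sqrt_pos.2 (hpos t)).ne'
  rw [integral_eq_sub_of_hasDerivAt hder (hcont.intervalIntegrable _ _)]
  congr 2
  rw [zero_sub, neg_sq]; ring

/-- Lower bound for the exponential of `segmentPotential` (see `segmentPotential_eq`) at a point
near the segment. Here `τ` is the coordinate of the point along the segment, `Q` its squared
distance to the line plus the regularisation, and `a`, `b` are the regularised distances to the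
two ends. -/
lemma le_exp_potential_of_near {N τ Q a b D t : ℝ} (hQ : 0 < Q) (ha : 0 < a) (hb : 0 < b)
    (ha2 : a ^ 2 = τ ^ 2 + Q) (hb2 : b ^ 2 = (N - τ) ^ 2 + Q) (ht0 : 0 ≤ t) (htN : t ≤ N)
    (hD : (t - τ) ^ 2 + Q ≤ D) (hN : 0 < N) :
    2 * N ^ 2 / D ≤ (N - τ + b) / (a - τ) * ((N + √(N ^ 2 + a ^ 2)) / a) *
      ((N + √(N ^ 2 + b ^ 2)) / b) := by
  have hD0 : 0 < D := by nlinarith [sq_nonneg (t - τ)]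
  have haτ : 0 < a - τ := by nlinarith
  have hbτ : 0 < N - τ + b := by nlinarith
  have hX : 0 < (N - τ + b) / (a - τ) := div_pos hbτ haτ
  have hYa : 2 * N ≤ N + √(N ^ 2 + a ^ 2) := by
    have := Real.le_sqrt_of_sq_le (x := N) (y := N ^ 2 + a ^ 2) (by nlinarith)
    linarith
  have hYb : 2 * N ≤ N + √(N ^ 2 + b ^ 2) := by
    have := Real.le_sqrt_of_sq_le (x := N) (y := N ^ 2 + b ^ 2) (by nlinarith)
    linarith
  -- Everything reduces to a bound on the contribution of the segment itself.
  suffices h : a * b / (2 * D) ≤ (N - τ + b) / (a - τ) by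
    calc 2 * N ^ 2 / D = a * b / (2 * D) * (2 * N / a) * (2 * N / b) := by
          field_simp
      _ ≤ _ := by gcongr
  rw [div_le_div_iff₀ (by positivity) haτ]
  have hfac : (a - τ) * (a + τ) = Q := by linear_combination ha2
  rcases lt_or_ge τ 0 with h | h
  · have h1 : a ^ 2 ≤ D := by nlinarith [mul_nonneg ht0 (neg_nonneg.2 h.le)]
    have h2 : a - τ ≤ 2 * a := by nlinarith
    calc a * b * (a - τ) ≤ a * b * (2 * a) := by gcongr
      _ = b * (2 * a ^ 2) := by ring
      _ ≤ _ := by gcongr; linarith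
  rcases le_or_gt τ N with h' | h'
  · have h1 : Q ≤ D := by nlinarith [sq_nonneg (t - τ)]
    calc a * b * (a - τ) ≤ (a + τ) * b * (a - τ) := by gcongr; linarith
      _ = b * Q := by rw [← hfac]; ring
      _ ≤ (N - τ + b) * (2 * D) := by gcongr <;> linarith
  · have h1 : b ^ 2 ≤ D := by nlinarith [mul_nonneg (sub_nonneg.2 htN) (sub_nonneg.2 h'.le)]
    have h2 : b + (τ - N) ≤ 2 * b := by nlinarith
    have h3 : (N - τ + b) * (b + (τ - N)) = Q := by linear_combination hb2
    have h4 : Q ≤ (N - τ + b) * (2 * b) := by rw [← h3]; gcongr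
    calc a * b * (a - τ) ≤ (a + τ) * b * (a - τ) := by gcongr; linarith
      _ = b * Q := by rw [← hfac]; ring
      _ ≤ b * ((N - τ + b) * (2 * b)) := by gcongr
      _ = (N - τ + b) * (2 * b ^ 2) := by ring
      _ ≤ _ := by gcongr

/-- The case of `exp_potential_le_of_far` of a point beyond the end `0`. -/
lemma exp_potential_le_of_far_of_neg {N τ Q a b R : ℝ} (hQ : 0 < Q) (ha : 0 < a) (hb : 0 < b)
    (ha2 : a ^ 2 = τ ^ 2 + Q) (hb2 : b ^ 2 = (N - τ) ^ 2 + Q) (hR : 0 < R) (hRN : R ≤ N)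
    (hτ : τ < 0) (hRa : R ^ 2 ≤ a ^ 2) :
    (N - τ + b) / (a - τ) * ((N + √(N ^ 2 + a ^ 2)) / a) * ((N + √(N ^ 2 + b ^ 2)) / b) ≤
      32 * N ^ 2 / R ^ 2 := by
  have hN : 0 < N := hR.trans_le hRN
  have hRa' : R ≤ a := le_of_sq_le_sq hRa ha.le
  have hτa : -τ ≤ a := by nlinarith
  have hbN : N - τ ≤ b := by nlinarith
  have hba : b ≤ N + a := le_of_sq_le_sq (by nlinarith) (by positivity)
  have hsa : √(N ^ 2 + a ^ 2) ≤ N + a := Real.sqrt_le_iff.2 ⟨by positivity, by nlinarith⟩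
  have hsb : √(N ^ 2 + b ^ 2) ≤ N + b := Real.sqrt_le_iff.2 ⟨by positivity, by nlinarith⟩
  calc _ ≤ (2 * b) / a * ((N + (N + a)) / a) * ((N + (N + b)) / b) := by
        gcongr <;> linarith
    _ ≤ (2 * b) / a * ((2 * N + a) / a) * ((3 * N + a) / b) := by
        gcongr (2 * b) / a * (?_ / a) * (?_ / b) <;> linarith
    _ = 2 * ((2 * N + a) / a) * ((3 * N + a) / a) := by field_simp
    _ ≤ 2 * (3 * N / R) * (4 * N / R) := by
        gcongr 2 * ?_ * ?_
        · rw [div_le_div_iff₀ ha hR]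
          nlinarith [mul_le_mul_of_nonneg_left hRa' hN.le, mul_le_mul_of_nonneg_left hRN ha.le]
        · rw [div_le_div_iff₀ ha hR]
          nlinarith [mul_le_mul_of_nonneg_left hRa' hN.le, mul_le_mul_of_nonneg_left hRN ha.le]
    _ = 24 * N ^ 2 / R ^ 2 := by field_simp; norm_num
    _ ≤ _ := by gcongr; norm_num

/-- Upper bound for the exponential of `segmentPotential`, in the notation of
`le_exp_potential_of_near`, at a point at distance at least `R` from the segment. There is no
restriction to a neighbourhood of the segment, and points near the line but beyond an end of the
segment are included. -/
lemma exp_potential_le_of_far {N τ Q a b R : ℝ} (hQ : 0 < Q) (ha : 0 < a) (hb : 0 < b)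
    (ha2 : a ^ 2 = τ ^ 2 + Q) (hb2 : b ^ 2 = (N - τ) ^ 2 + Q) (hR : 0 < R) (hRN : R ≤ N)
    (hfar : ∀ t, 0 ≤ t → t ≤ N → R ^ 2 ≤ (t - τ) ^ 2 + Q) :
    (N - τ + b) / (a - τ) * ((N + √(N ^ 2 + a ^ 2)) / a) * ((N + √(N ^ 2 + b ^ 2)) / b) ≤
      32 * N ^ 2 / R ^ 2 := by
  have hN : 0 < N := hR.trans_le hRN
  have haτ : 0 < a - τ := by nlinarith
  have hfac : (a - τ) * (a + τ) = Q := by linear_combination ha2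
  rcases lt_or_ge τ 0 with h | h
  · refine exp_potential_le_of_far_of_neg hQ ha hb ha2 hb2 hR hRN h ?_
    have := hfar 0 le_rfl hN.le
    rw [ha2]; linarith
  rcases lt_or_ge N τ with h' | h'
  · -- Reversing the segment exchanges `a` with `b` and `τ` with `N - τ`.
    have hbτ : 0 < b - (N - τ) := by nlinarith
    have := exp_potential_le_of_far_of_neg (N := N) (τ := N - τ) hQ hb ha hb2
      (by rw [ha2]; ring) hR hRN (by linarith) (by
        have := hfar N hN.le le_rfl
        rw [hb2]; linarith)
    have hX : (N - (N - τ) + a) / (b - (N - τ)) = (N - τ + b) / (a - τ) := by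
      rw [div_eq_div_iff hbτ.ne' haτ.ne']
      linear_combination ha2 - hb2
    rw [hX] at this
    linarith
  · have hRQ : R ^ 2 ≤ Q := by have := hfar τ h h'; simpa using this
    have hτa : τ ≤ a := by nlinarith
    have hbN : N - τ ≤ b := by nlinarith
    have hX : (N - τ + b) / (a - τ) ≤ 4 * a * b / Q := by
      rw [div_le_div_iff₀ haτ hQ, ← hfac]
      calc (N - τ + b) * ((a - τ) * (a + τ)) ≤ (2 * b) * ((a - τ) * (2 * a)) := by
            gcongr <;> linarith
        _ = _ := by ring
    have hsa : √(N ^ 2 + a ^ 2) ≤ √(2 * N ^ 2 + Q) := Real.sqrt_le_sqrt (by nlinarith)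
    have hsb : √(N ^ 2 + b ^ 2) ≤ √(2 * N ^ 2 + Q) := Real.sqrt_le_sqrt (by nlinarith)
    have hP : √(2 * N ^ 2 + Q) ^ 2 = 2 * N ^ 2 + Q := Real.sq_sqrt (by positivity)
    calc _ ≤ 4 * a * b / Q * ((N + √(2 * N ^ 2 + Q)) / a) * ((N + √(2 * N ^ 2 + Q)) / b) := by
          gcongr
      _ = 4 * (N + √(2 * N ^ 2 + Q)) ^ 2 / Q := by field_simp
      _ ≤ (24 * N ^ 2 + 8 * Q) / Q := by
          gcongr
          nlinarith [sq_nonneg (N - √(2 * N ^ 2 + Q))]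
      _ = 24 * N ^ 2 / Q + 8 := by field_simp
      _ ≤ 24 * N ^ 2 / R ^ 2 + 8 * N ^ 2 / R ^ 2 := by
          gcongr
          rw [le_div_iff₀ (by positivity)]
          gcongr
      _ = _ := by ring

/-- The potential of the segment from `0` to `N • e`, prolonged at either end by a segment of
length `N` pointing into a fourth dimension: adding `t ^ 2` to the regularisation has the effect
of moving the pole a distance `t` orthogonally to `ℝ³`. The prolongations make the potential of
the same size near the ends as in the middle. -/
noncomputable def segmentPotential (N : ℝ) (e v : EuclideanSpace ℝ (Fin 3)) : ℝ :=
  ∫ t in (0 : ℝ)..N, (newtonKernel (v - t • e) 100 + newtonKernel v (100 + t ^ 2) +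
    newtonKernel (v - N • e) (100 + t ^ 2))

lemma continuous_newtonKernel_comp {f : ℝ → EuclideanSpace ℝ (Fin 3)} {g : ℝ → ℝ}
    (hf : Continuous f) (hg : Continuous g) (h0 : ∀ t, 0 < g t) :
    Continuous fun t => newtonKernel (f t) (g t) :=
  Continuous.inv₀ (by fun_prop) fun t =>
    (Real.sqrt_pos.2 (by have := h0 t; positivity)).ne'

lemma continuous_segmentPotential_integrand (N : ℝ) (e v : EuclideanSpace ℝ (Fin 3)) :
    Continuous fun t : ℝ => newtonKernel (v - t • e) 100 + newtonKernel v (100 + t ^ 2) +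
      newtonKernel (v - N • e) (100 + t ^ 2) :=
  ((continuous_newtonKernel_comp (by fun_prop) continuous_const fun _ => by norm_num).add
    (continuous_newtonKernel_comp continuous_const (by fun_prop) fun t => by positivity)).add
    (continuous_newtonKernel_comp continuous_const (by fun_prop) fun t => by positivity)

lemma segmentPotential_nonneg {N : ℝ} (hN : 0 ≤ N) (e v : EuclideanSpace ℝ (Fin 3)) :
    0 ≤ segmentPotential N e v :=
  integral_nonneg hN fun _ _ => add_nonneg (add_nonneg (newtonKernel_nonneg _ _)
    (newtonKernel_nonneg _ _)) (newtonKernel_nonneg _ _)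

/-- The potential is superharmonic for the nearest neighbour walk, on the whole lattice. -/
lemma sum_segmentPotential_le {N : ℝ} (hN : 0 ≤ N) (e v : EuclideanSpace ℝ (Fin 3)) :
    ∑ σ : Fin 3 × Bool, segmentPotential N e (v + latticeEmb (unitStep σ)) ≤
      6 * segmentPotential N e v := by
  have hint : ∀ w, IntervalIntegrable (fun t : ℝ => newtonKernel (w - t • e) 100 +
      newtonKernel w (100 + t ^ 2) + newtonKernel (w - N • e) (100 + t ^ 2)) volume 0 N :=
    fun w => (continuous_segmentPotential_integrand N e w).intervalIntegrable _ _
  unfold segmentPotential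
  rw [← intervalIntegral.integral_finsetSum fun σ _ => hint _,
    ← intervalIntegral.integral_const_mul]
  refine integral_mono_on hN (Continuous.intervalIntegrable (continuous_finsetSum _ fun σ _ =>
    continuous_segmentPotential_integrand N e _) _ _) ((hint v).const_mul 6) fun t _ => ?_
  have h1 := sum_newtonKernel_le (v - t • e) le_rfl
  have h2 := sum_newtonKernel_le v (s := 100 + t ^ 2) (by nlinarith)
  have h3 := sum_newtonKernel_le (v - N • e) (s := 100 + t ^ 2) (by nlinarith)
  simp only [add_sub_right_comm, Finset.sum_add_distrib] at h1 h2 h3 ⊢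
  linarith

lemma norm_sub_smul_sq {e : EuclideanSpace ℝ (Fin 3)} (he : ‖e‖ = 1)
    (v : EuclideanSpace ℝ (Fin 3)) (t : ℝ) :
    ‖v - t • e‖ ^ 2 = (t - inner ℝ v e) ^ 2 + (‖v‖ ^ 2 - inner ℝ v e ^ 2) := by
  rw [norm_sub_sq_real, inner_smul_right, norm_smul, he, mul_one, Real.norm_eq_abs, sq_abs]
  ring

/-- Closed form of the potential, with all integrals evaluated. -/
lemma segmentPotential_eq {N : ℝ} {e : EuclideanSpace ℝ (Fin 3)} (hN : 0 < N) (he : ‖e‖ = 1)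
    (v : EuclideanSpace ℝ (Fin 3)) :
    ∃ τ Q a b : ℝ, 0 < Q ∧ 0 < a ∧ 0 < b ∧ a ^ 2 = τ ^ 2 + Q ∧ b ^ 2 = (N - τ) ^ 2 + Q ∧
      (∀ t, ‖v - t • e‖ ^ 2 + 100 = (t - τ) ^ 2 + Q) ∧
      0 < (N - τ + b) / (a - τ) * ((N + √(N ^ 2 + a ^ 2)) / a) *
        ((N + √(N ^ 2 + b ^ 2)) / b) ∧
      segmentPotential N e v = Real.log ((N - τ + b) / (a - τ) *
        ((N + √(N ^ 2 + a ^ 2)) / a) * ((N + √(N ^ 2 + b ^ 2)) / b)) := by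
  set τ := inner ℝ v e with hτ
  set Q := ‖v‖ ^ 2 - τ ^ 2 + 100 with hQdef
  have hτv : τ ^ 2 ≤ ‖v‖ ^ 2 := by
    have := norm_sub_smul_sq he v τ
    nlinarith [sq_nonneg ‖v - τ • e‖]
  have hQ : 0 < Q := by linarith
  have hdist : ∀ t, ‖v - t • e‖ ^ 2 + 100 = (t - τ) ^ 2 + Q := fun t => by
    rw [norm_sub_smul_sq he, hQdef]; ring
  set a := √(τ ^ 2 + Q) with hadef
  set b := √((N - τ) ^ 2 + Q) with hbdef
  have ha : 0 < a := Real.sqrt_pos.2 (by positivity)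
  have hb : 0 < b := Real.sqrt_pos.2 (by positivity)
  have ha2 : a ^ 2 = τ ^ 2 + Q := Real.sq_sqrt (by positivity)
  have hb2 : b ^ 2 = (N - τ) ^ 2 + Q := Real.sq_sqrt (by positivity)
  have haτ : 0 < a - τ := by nlinarith
  have hbτ : 0 < N - τ + b := by nlinarith
  refine ⟨τ, Q, a, b, hQ, ha, hb, ha2, hb2, hdist, by positivity, ?_⟩
  have e1 : ∫ t in (0 : ℝ)..N, newtonKernel (v - t • e) 100 =
      Real.log (N - τ + b) - Real.log (a - τ) := by
    rw [hadef, hbdef, ← integral_inv_sqrt_sub_sq_add τ N hQ]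
    simp only [newtonKernel, hdist]
  have e2 : ∀ w : EuclideanSpace ℝ (Fin 3), ∀ c : ℝ, 0 < c → ‖w‖ ^ 2 + 100 = c ^ 2 →
      ∫ t in (0 : ℝ)..N, newtonKernel w (100 + t ^ 2) =
        Real.log (N + √(N ^ 2 + c ^ 2)) - Real.log c := by
    intro w c hc hw
    have := integral_inv_sqrt_sub_sq_add 0 N (Q := c ^ 2) (by positivity)
    simp only [sub_zero, zero_pow two_ne_zero, zero_add, Real.sqrt_sq hc.le] at this
    rw [← this]
    refine integral_congr fun t _ => ?_
    simp only [newtonKernel]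
    rw [← add_assoc, hw, add_comm]
  have hv : ‖v‖ ^ 2 + 100 = a ^ 2 := by rw [ha2, hQdef]; ring
  have i1 : Continuous fun t : ℝ => newtonKernel (v - t • e) 100 :=
    continuous_newtonKernel_comp (by fun_prop) continuous_const fun _ => by norm_num
  have i2 : ∀ w, Continuous fun t : ℝ => newtonKernel w (100 + t ^ 2) := fun w =>
    continuous_newtonKernel_comp continuous_const (by fun_prop) fun t => by positivity
  have i3 : Continuous fun t : ℝ =>
      newtonKernel (v - t • e) 100 + newtonKernel v (100 + t ^ 2) := i1.add (i2 v)
  rw [segmentPotential, integral_add (i3.intervalIntegrable _ _)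
    ((i2 _).intervalIntegrable _ _), integral_add (i1.intervalIntegrable _ _)
    ((i2 _).intervalIntegrable _ _), e1, e2 v a ha hv, e2 _ b hb ((hdist N).trans hb2.symm),
    Real.log_mul (by positivity) (by positivity), Real.log_mul (by positivity) (by positivity),
    Real.log_div (by positivity) (by positivity), Real.log_div (by positivity) (by positivity),
    Real.log_div (by positivity) (by positivity)]

lemma log_le_segmentPotential {N t D : ℝ} {e v : EuclideanSpace ℝ (Fin 3)} (hN : 0 < N)
    (he : ‖e‖ = 1) (ht0 : 0 ≤ t) (htN : t ≤ N) (hD : ‖v - t • e‖ ^ 2 + 100 ≤ D) :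
    Real.log (2 * N ^ 2 / D) ≤ segmentPotential N e v := by
  obtain ⟨τ, Q, a, b, hQ, ha, hb, ha2, hb2, hdist, hpos, heq⟩ := segmentPotential_eq hN he v
  rw [hdist] at hD
  rw [heq]
  have hD0 : 0 < D := by nlinarith [sq_nonneg (t - τ)]
  exact Real.log_le_log (by positivity) (le_exp_potential_of_near hQ ha hb ha2 hb2 ht0 htN hD hN)

lemma segmentPotential_le_log {N R : ℝ} {e v : EuclideanSpace ℝ (Fin 3)} (he : ‖e‖ = 1)
    (hR : 0 < R) (hRN : R ≤ N) (hfar : ∀ t, 0 ≤ t → t ≤ N → R ≤ ‖v - t • e‖) :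
    segmentPotential N e v ≤ Real.log (32 * N ^ 2 / R ^ 2) := by
  obtain ⟨τ, Q, a, b, hQ, ha, hb, ha2, hb2, hdist, hpos, heq⟩ :=
    segmentPotential_eq (hR.trans_le hRN) he v
  rw [heq]
  refine Real.log_le_log hpos (exp_potential_le_of_far hQ ha hb ha2 hb2 hR hRN fun t h0 h1 => ?_)
  rw [← hdist]
  have : R ^ 2 ≤ ‖v - t • e‖ ^ 2 := by gcongr; exact hfar t h0 h1
  linarith

/-! ### Geometry of the discretised tubes -/

lemma latticeEmb_add {d : ℕ} (x y : Fin d → ℤ) :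
    latticeEmb (x + y) = latticeEmb x + latticeEmb y := by
  ext i; simp [latticeEmb]

lemma dist_latticeEmb_nearest_le {rnd : EuclideanSpace ℝ (Fin 3) → Fin 3 → ℤ}
    (h : IsNearestLatticePoint rnd) (z : EuclideanSpace ℝ (Fin 3)) :
    dist z (latticeEmb (rnd z)) ≤ 1 := by
  refine (h z fun i => round (z i)).trans ?_
  rw [EuclideanSpace.dist_eq, Real.sqrt_le_iff, one_pow]
  refine ⟨zero_le_one, ?_⟩
  have : ∀ i, dist (z i) ((latticeEmb fun i => round (z i)) i) ^ 2 ≤ 1 / 4 := fun i => by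
    rw [Real.dist_eq, sq_abs]
    have h1 := abs_le.1 (abs_sub_round (z i))
    simp only [latticeEmb]
    nlinarith [h1.1, h1.2]
  rw [Fin.sum_univ_three]
  linarith [this 0, this 1, this 2]

lemma norm_latticeDir {d : ℕ} {x : Fin d → ℤ} (hx : 0 < latticeNorm x) :
    ‖latticeDir x‖ = 1 := by
  rw [latticeDir, norm_smul, norm_inv, Real.norm_of_nonneg hx.le]
  exact inv_mul_cancel₀ hx.ne'

lemma dist_smul_smul_of_norm_eq_one {e : EuclideanSpace ℝ (Fin 3)} (he : ‖e‖ = 1) (s t : ℝ) :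
    dist (s • e) (t • e) = |s - t| := by
  rw [dist_eq_norm, ← sub_smul, norm_smul, he, mul_one, Real.norm_eq_abs]

lemma exists_norm_sub_smul_le_of_mem_obliqueTube {rnd : EuclideanSpace ℝ (Fin 3) → Fin 3 → ℤ}
    (hrnd : IsNearestLatticePoint rnd) {x y : Fin 3 → ℤ} {r : ℝ} (hx : 0 < latticeNorm x)
    (hy : y ∈ obliqueTube rnd x r) :
    ∃ t, 0 ≤ t ∧ t ≤ latticeNorm x ∧ ‖latticeEmb y - t • latticeDir x‖ ≤ r + 3 := by
  have hne : (latticeEmb '' obliqueLine rnd x).Nonempty :=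
    ⟨_, _, ⟨0, Nat.zero_le _, rfl⟩, rfl⟩
  obtain ⟨_, ⟨_, ⟨j, hj, rfl⟩, rfl⟩, hu⟩ :=
    (Metric.infDist_lt_iff hne).1 (lt_of_le_of_lt hy (lt_add_one r))
  -- The last index may exceed `|x|`, by less than one.
  have hjN : (j : ℝ) ≤ latticeNorm x + 1 :=
    (Nat.cast_le.2 hj).trans (Nat.ceil_lt_add_one hx.le).le
  refine ⟨min j (latticeNorm x), le_min (Nat.cast_nonneg j) hx.le, min_le_right _ _, ?_⟩
  have h1 := dist_latticeEmb_nearest_le hrnd ((j : ℝ) • latticeDir x)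
  have h2 : dist ((j : ℝ) • latticeDir x) (min (j : ℝ) (latticeNorm x) • latticeDir x) ≤ 1 := by
    rw [dist_smul_smul_of_norm_eq_one (norm_latticeDir hx), abs_le]
    constructor <;> rcases min_cases (j : ℝ) (latticeNorm x) with ⟨h, _⟩ | ⟨h, _⟩ <;> rw [h] <;>
      linarith
  rw [← dist_eq_norm]
  have h3 := dist_triangle4 (latticeEmb y) (latticeEmb (rnd ((j : ℝ) • latticeDir x)))
    ((j : ℝ) • latticeDir x) (min (j : ℝ) (latticeNorm x) • latticeDir x)
  rw [dist_comm] at h1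
  linarith

lemma sub_two_le_norm_sub_smul_of_notMem_obliqueTube
    {rnd : EuclideanSpace ℝ (Fin 3) → Fin 3 → ℤ} (hrnd : IsNearestLatticePoint rnd)
    {x y : Fin 3 → ℤ} {R t : ℝ} (hx : 0 < latticeNorm x) (hy : y ∉ obliqueTube rnd x R)
    (ht0 : 0 ≤ t) (htN : t ≤ latticeNorm x) :
    R - 2 ≤ ‖latticeEmb y - t • latticeDir x‖ := by
  have hmem : latticeEmb (rnd ((⌊t⌋₊ : ℝ) • latticeDir x)) ∈ latticeEmb '' obliqueLine rnd x :=
    ⟨_, ⟨⌊t⌋₊, (Nat.floor_mono htN).trans (Nat.floor_le_ceil _), rfl⟩, rfl⟩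
  have hd := (not_le.1 hy).trans_le (Metric.infDist_le_dist_of_mem hmem)
  have h1 := dist_latticeEmb_nearest_le hrnd ((⌊t⌋₊ : ℝ) • latticeDir x)
  have h2 : dist (t • latticeDir x) ((⌊t⌋₊ : ℝ) • latticeDir x) ≤ 1 := by
    rw [dist_smul_smul_of_norm_eq_one (norm_latticeDir hx), abs_le]
    constructor <;> linarith [Nat.floor_le ht0, Nat.lt_floor_add_one t]
  rw [← dist_eq_norm]
  have h3 := dist_triangle4 (latticeEmb y) (t • latticeDir x) ((⌊t⌋₊ : ℝ) • latticeDir x)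
    (latticeEmb (rnd ((⌊t⌋₊ : ℝ) • latticeDir x)))
  linarith

/-! ### The escape estimate -/

theorem proposition2p1 :
    ∃ c : ℝ, 0 < c ∧
      ∀ δ ε : ℝ, 0 < δ → δ < 1 → 0 < ε → ε < 1 →
        ∃ C : ℝ, 0 < C ∧
          ∀ rnd : EuclideanSpace ℝ (Fin 3) → Fin 3 → ℤ, IsNearestLatticePoint rnd →
            ∀ x : Fin 3 → ℤ, C ≤ latticeNorm x →
              ENNReal.ofReal (c * δ * ε) ≤
                ⨅ y ∈ (obliqueTube rnd x (latticeNorm x ^ δ))ᶜ,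
                  escapeProb y (obliqueTube rnd x (latticeNorm x ^ ((1 - ε) * δ))) := by
  refine ⟨1 / 2, by norm_num, fun δ ε hδ0 hδ1 hε0 hε1 =>
    ⟨Real.exp (200 / (δ * ε)), Real.exp_pos _, fun rnd hrnd x hx => ?_⟩⟩
  refine le_iInf₂ fun y hy => ?_
  set N := latticeNorm x with hNdef
  have hN : 0 < N := (Real.exp_pos _).trans_le hx
  set L := Real.log N with hL
  have hδε : 0 < δ * ε := mul_pos hδ0 hε0
  have hL200 : 200 ≤ δ * ε * L := by
    have h1 : 200 / (δ * ε) ≤ L := (Real.le_log_iff_exp_le hN).2 hx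
    rw [div_le_iff₀ hδε] at h1
    linarith
  have hL0 : 0 < L := by
    by_contra h
    nlinarith [mul_nonneg hδε.le (neg_nonneg.2 (not_lt.1 h))]
  have hN1 : 1 ≤ N := ((Real.log_pos_iff hN.le).1 hL0).le
  have hδL : 200 ≤ δ * L := by nlinarith [mul_pos hδ0 hL0]
  set r := N ^ ((1 - ε) * δ) with hr
  set R := N ^ δ with hRdef
  have hr1 : 1 ≤ r := Real.one_le_rpow hN1 (mul_nonneg (by linarith) hδ0.le)
  have hRN : R ≤ N := by
    simpa using Real.rpow_le_rpow_of_exponent_le hN1 hδ1.le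
  have hR4 : 4 ≤ R := by
    rw [hRdef, Real.rpow_def_of_pos hN, mul_comm]
    linarith [Real.add_one_le_exp (δ * L)]
  have hlogr : Real.log r = (1 - ε) * δ * L := Real.log_rpow hN _
  have hlogR : Real.log R = δ * L := Real.log_rpow hN _
  set e := latticeDir x
  have he : ‖e‖ = 1 := norm_latticeDir hN
  set m := Real.log (2 * N ^ 2 / (116 * r ^ 2)) with hm
  have hmeq : m = 2 * L - 2 * ((1 - ε) * δ * L) - Real.log 58 := by
    rw [hm, show 2 * N ^ 2 / (116 * r ^ 2) = N ^ 2 / (58 * r ^ 2) by field_simp; norm_num,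
      Real.log_div (by positivity) (by positivity), Real.log_mul (by norm_num) (by positivity),
      Real.log_pow, Real.log_pow, hlogr]
    push_cast; ring
  have hupper : segmentPotential N e (latticeEmb y) ≤ Real.log 128 + 2 * L - 2 * (δ * L) := by
    refine (segmentPotential_le_log he (R := R / 2) (by linarith) (by linarith)
      fun t h0 h1 => ?_).trans (le_of_eq ?_)
    · have := sub_two_le_norm_sub_smul_of_notMem_obliqueTube hrnd hN hy h0 h1
      linarith
    · rw [show 32 * N ^ 2 / (R / 2) ^ 2 = 128 * N ^ 2 / R ^ 2 by field_simp; norm_num,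
        Real.log_div (by positivity) (by positivity),
        Real.log_mul (by norm_num) (by positivity), Real.log_pow, Real.log_pow, hlogR]
      push_cast; ring
  have hlower : ∀ z ∈ obliqueTube rnd x r, m ≤ segmentPotential N e (latticeEmb z) := by
    intro z hz
    obtain ⟨t, h0, h1, ht⟩ := exists_norm_sub_smul_le_of_mem_obliqueTube hrnd hN hz
    refine log_le_segmentPotential hN he h0 h1 ?_
    have : ‖latticeEmb z - t • e‖ ^ 2 ≤ (r + 3) ^ 2 := by gcongr
    nlinarith
  have h58 : Real.log 58 ≤ 57 := by
    have := Real.log_le_sub_one_of_pos (x := 58) (by norm_num); linarith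
  have h128 : Real.log 128 ≤ 127 := by
    have := Real.log_le_sub_one_of_pos (x := 128) (by norm_num); linarith
  have h58' : 0 ≤ Real.log 58 := Real.log_nonneg (by norm_num)
  have hm0 : 0 < m := by
    have : 0 ≤ (1 - δ) * L := mul_nonneg (by linarith) hL0.le
    rw [hmeq]; linarith
  have hm2 : m ≤ 2 * L := by
    have : 0 ≤ (1 - ε) * δ * L := mul_nonneg (mul_nonneg (by linarith) hδ0.le) hL0.le
    rw [hmeq]; linarith
  refine le_trans (ENNReal.ofReal_le_ofReal ?_) (le_escapeProb
    (f := fun z => segmentPotential N e (latticeEmb z))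
    (fun z => segmentPotential_nonneg hN.le _ _) (fun z => ?_) hm0 hlower y)
  · -- With `L = log N`, the potential is at most `2 (1 - δ) L + O(1)` at `y`, and at least
    -- `m = 2 (1 - δ + δ ε) L - O(1)` on the tube. By the choice of `C`, the term
    -- `δ ε L` absorbs the `O(1)`.
    rw [le_sub_comm, div_le_iff₀ hm0]
    have h1 : δ * ε * m ≤ δ * ε * (2 * L) := by gcongr
    linarith
  · simp only [latticeEmb_add]
    have := sum_segmentPotential_le hN.le e (latticeEmb z)
    norm_num
    exact this
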